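/- Let $E\stackrel{p}{\to}B\stackrel{f}{\to}Y$ be continuous maps of topological spaces, where $B$ has the homotopy type of a CW-complex. An open set $U\subset B$ is $f$-categorical if there is a continuous map $s\colon U\to E$ with $fps\simeq f_{|U}$, and $\operatorname{secat}_f(p)$ is the least $n\le\infty$ such that $B$ can be covered by $n+1$ $f$-categorical open sets. (Homotopies, local sections and lifts are not required to preserve base points, and "the least integer" is $\infty$ if there is none.) For a map $q\colon Z\to Y$ let $*^0_Yq=q\colon *^0_YZ=Z\to Y$ and, inductively, let $*^{n+1}_YZ$ be the double mapping cylinder of the projections $*^n_YZ\leftarrow(*^n_YZ)\times_YZ\to Z$, that is, the quotient space of $\bigl((*^n_YZ)\times_YZ\bigr)\times[0,1]\amalg *^n_YZ\amalg Z$ by $(x,y,0)\sim x$, $(x,y,1)\sim y$, with the map $*^{n+1}_Yq\colon *^{n+1}_YZ\to Y$, $[x,y,t]\mapsto(*^n_Yq)(x)=q(y)$, which is $*^n_Yq$ and $q$ on the two ends. Write also $g=fp\colon E\to Y$, let $\circledast^0_Yg=g\colon\circledast^0_YE=E\to Y$ and, inductively, let $\circledast^{n+1}_YE$ (the homotopy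 join) be the homotopy pushout of the homotopy pullback of $\circledast^n_Yg$ and $g$: the double mapping cylinder of the two projections of the space of triples $(x,\gamma,y)$, with $x\in\circledast^n_YE$, $y\in E$ and $\gamma\colon[0,1]\to Y$ a path from $(\circledast^n_Yg)(x)$ to $g(y)$; its map $\circledast^{n+1}_Yg$ to $Y$ is $[x,\gamma,y,t]\mapsto\gamma(t)$, and is $\circledast^n_Yg$ and $g$ on the two ends. (1) Suppose $fp=qj$ with $j\colon E\to Z$ a homotopy equivalence and $q\colon Z\to Y$ a (Hurewicz) fibration. Then $\operatorname{secat}_f(p)$ is the least integer $n\ge 0$ for which there exists a continuous map $\sigma\colon B\to *^n_YZ$ such that $(*^n_Yq)\sigma=f$. It is also the least integer $n\ge 0$ for which there exists a continuous map $\sigma\colon B\to *^n_YZ$ such that $(*^n_Yq)\sigma\simeq f$. (2) $\operatorname{secat}_f(p)$ is the least integer $n\ge 0$ for which there exists a continuous map $\sigma\colon B\to\circledast^n_YE$ such that $(\circledast^n_Yfp)\sigma\simeq f$. -/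

import Mathlib

open scoped unitInterval ContinuousMap

universe u

/-- `B` has the homotopy type of a CW-complex. -/
def HasCWHomotopyType (B : Type u) [TopologicalSpace B] : Prop :=
  ∃ (K : Type u) (_ : TopologicalSpace K) (_ : T2Space K),
    Nonempty (Topology.CWComplex (Set.univ : Set K)) ∧ Nonempty (B ≃ₕ K)

/-- Hurewicz fibration: the homotopy lifting property with respect to every space `A`. -/
def IsHurewiczFibration {Z Y : Type u} [TopologicalSpace Z] [TopologicalSpace Y]
    (q : C(Z, Y)) : Prop :=
  ∀ (A : Type u) [TopologicalSpace A] (g : C(A, Z)) (H : C(A × I, Y)),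
    (∀ a, H (a, 0) = q (g a)) →
      ∃ G : C(A × I, Z), (∀ a, G (a, 0) = g a) ∧ ∀ x, q (G x) = H x

/-- The least natural number satisfying `P`, which is `⊤` (infinity) if there is none. -/
noncomputable def leastNat (P : ℕ → Prop) : ℕ∞ :=
  sInf ((fun n : ℕ => (n : ℕ∞)) '' {n | P n})

section Secat

variable {E B Y : Type u} [TopologicalSpace E] [TopologicalSpace B] [TopologicalSpace Y]

/-- For `E --p--> B --f--> Y`, an open set `U ⊆ B` is `f`-categorical if there is a map
`s : U → E` (an `f`-section) such that `f ∘ p ∘ s` is homotopic to the restriction of `f`. -/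
def IsCategoricalSet (f : C(B, Y)) (p : C(E, B)) (U : Set B) : Prop :=
  IsOpen U ∧ ∃ s : C(U, E), ((f.comp p).comp s).Homotopic (f.restrict U)

/-- The `f`-sectional category of `p`: the least `n ≤ ∞` such that `B` is covered by
`n + 1` `f`-categorical open sets. -/
noncomputable def secat (f : C(B, Y)) (p : C(E, B)) : ℕ∞ :=
  leastNat fun n => ∃ U : Fin (n + 1) → Set B,
    (∀ i, IsCategoricalSet f p (U i)) ∧ ⋃ i, U i = Set.univ

end Secat

section Cylinder

variable {P Z W Y : Type u} [TopologicalSpace P] [TopologicalSpace Z] [TopologicalSpace W]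
  [TopologicalSpace Y]

/-- The identifications `(x, 0) ∼ a x` and `(x, 1) ∼ b x`. -/
inductive CylinderRel (a : C(P, Z)) (b : C(P, W)) : (P × I) ⊕ (Z ⊕ W) → (P × I) ⊕ (Z ⊕ W) → Prop
  | zero (x : P) : CylinderRel a b (Sum.inl (x, 0)) (Sum.inr (Sum.inl (a x)))
  | one (x : P) : CylinderRel a b (Sum.inl (x, 1)) (Sum.inr (Sum.inr (b x)))

/-- The double mapping cylinder of `Z <--a-- P --b--> W`, with the quotient topology. -/
def DoubleCylinder (a : C(P, Z)) (b : C(P, W)) : Type u :=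
  Quot (CylinderRel a b)

instance (a : C(P, Z)) (b : C(P, W)) : TopologicalSpace (DoubleCylinder a b) :=
  inferInstanceAs (TopologicalSpace (Quot (CylinderRel a b)))

/-- The map out of the double mapping cylinder given by maps `q`, `r` on the two ends and a
homotopy `H` from `q ∘ a` to `r ∘ b`: it sends `[x, t]` to `H (x, t)`. -/
def DoubleCylinder.desc (a : C(P, Z)) (b : C(P, W)) (q : C(Z, Y)) (r : C(W, Y))
    (H : C(P × I, Y)) (h0 : ∀ x, H (x, 0) = q (a x)) (h1 : ∀ x, H (x, 1) = r (b x)) :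
    C(DoubleCylinder a b, Y) where
  toFun := Quot.lift (Sum.elim H (Sum.elim q r)) (by
    rintro _ _ (x | x)
    · exact h0 x
    · exact h1 x)
  continuous_toFun := by
    apply continuous_coinduced_dom.mpr
    exact H.continuous.sumElim (q.continuous.sumElim r.continuous)

end Cylinder

/-- A space together with a map to `Y`. -/
structure SpaceOver (Y : Type u) [TopologicalSpace Y] where
  carrier : Type u
  [top : TopologicalSpace carrier]
  proj : C(carrier, Y)

attribute [instance] SpaceOver.top

section Joins

variable {Z W Y : Type u} [TopologicalSpace Z] [TopologicalSpace W] [TopologicalSpace Y]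

/-- The pullback `Z ×_Y W`. -/
abbrev FiberProduct (q : C(Z, Y)) (r : C(W, Y)) : Type u :=
  {x : Z × W // q x.1 = r x.2}

/-- The fiberwise join `q *_Y r : Z *_Y W → Y`: the double mapping cylinder of the projections of
`Z ×_Y W`, mapped to `Y` by `[x, y, t] ↦ q x = r y`. -/
def fiberwiseJoin (q : C(Z, Y)) (r : C(W, Y)) : SpaceOver Y where
  carrier := DoubleCylinder
    (⟨fun x => x.1.1, by fun_prop⟩ : C(FiberProduct q r, Z))
    (⟨fun x => x.1.2, by fun_prop⟩ : C(FiberProduct q r, W))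
  proj := DoubleCylinder.desc _ _ q r ⟨fun x => q x.1.1.1, by fun_prop⟩
    (fun _ => rfl) (fun x => x.2)

/-- The `n`-fold fiberwise join `*^n_Y q : *^n_Y Z → Y`, with `*^0_Y q = q` and
`*^(n+1)_Y q = (*^n_Y q) *_Y q`. -/
def iteratedJoin (q : C(Z, Y)) : ℕ → SpaceOver Y
  | 0 => ⟨Z, q⟩
  | n + 1 => fiberwiseJoin (iteratedJoin q n).proj q

/-- The (standard) homotopy pullback of `Z --q--> Y <--r-- W`: triples `(x, γ, y)` with `γ` a path
in `Y` from `q x` to `r y`, where paths carry the compact-open topology. -/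
abbrev HomotopyPullback (q : C(Z, Y)) (r : C(W, Y)) : Type u :=
  {x : Z × C(I, Y) × W // x.2.1 0 = q x.1 ∧ x.2.1 1 = r x.2.2}

/-- The homotopy join of `q` and `r` over `Y`: the (standard) homotopy pushout of the projections
of the homotopy pullback of `q` and `r`, mapped to `Y` by `[x, γ, y, t] ↦ γ t`. -/
def homotopyJoin (q : C(Z, Y)) (r : C(W, Y)) : SpaceOver Y where
  carrier := DoubleCylinder
    (⟨fun x => x.1.1, by fun_prop⟩ : C(HomotopyPullback q r, Z))
    (⟨fun x => x.1.2.2, by fun_prop⟩ : C(HomotopyPullback q r, W))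
  proj := DoubleCylinder.desc _ _ q r ⟨fun x => x.1.1.2.1 x.2, by fun_prop⟩
    (fun x => x.2.1) (fun x => x.2.2)

/-- The `n`-fold homotopy join, with `*^0_Y q = q` and `*^(n+1)_Y q = (*^n_Y q) *_Y q`. -/
def iteratedHomotopyJoin (q : C(Z, Y)) : ℕ → SpaceOver Y
  | 0 => ⟨Z, q⟩
  | n + 1 => homotopyJoin (iteratedHomotopyJoin q n).proj q

end Joins

/-! By definition `secat f p ≤ n` asks for `n + 1` open sets covering `B` over which `f` lifts
through `f ∘ p` up to homotopy (`HasLiftCover`). For each `n`, such a cover is shown to be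
equivalent to a lift to the `n`-fold join.

From a lift to a cover: the part of a double mapping cylinder away from one end retracts by
deformation to the other end. Pulling back these two open parts and inducting on `n` gives the cover
(`DoubleCylinder.exists_open_cover`, `hasLiftCover_of_liftsUpTo`).

From a cover to a lift: CW complexes are normal, so partitions of unity turn the cover into one by
cozero sets (`HasLiftCover.exists_numerable`). Over a fibration the homotopy lifts become strict,
and the functions serve as join coordinates to glue them (`LiftsTo.fiberwiseJoin`,
`liftsTo_of_numerable`). For the homotopy join the maps are replaced by path fibrations, whose
fiberwise join maps to the path fibration of the homotopy join (`liftsTo_fiberwiseJoin_pathProj`).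
-/

section CWNormal

/-! ### Normality of CW complexes -/

open Topology Metric Set Topology.CWComplex

/-- Closed subsets of the ball are compact, so their images in the Hausdorff space `X` are closed:
the characteristic map is a quotient map onto the closed cell. -/
theorem Topology.RelCWComplex.continuousOn_closedCell {X Y : Type*} [TopologicalSpace X]
    [TopologicalSpace Y] {C D : Set X} [T2Space X] [RelCWComplex C D] {n : ℕ}
    {e : RelCWComplex.cell C n} {h : X → Y}
    (hh : ContinuousOn (h ∘ RelCWComplex.map n e) (closedBall 0 1)) :
    ContinuousOn h (RelCWComplex.closedCell n e) := by
  rw [continuousOn_iff_isClosed] at hh ⊢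
  intro t ht
  obtain ⟨u, hu, hut⟩ := hh t ht
  refine ⟨RelCWComplex.map n e '' (u ∩ closedBall 0 1), ?_, ?_⟩
  · refine (((isCompact_closedBall 0 1).inter_left hu).image_of_continuousOn ?_).isClosed
    exact (RelCWComplex.continuousOn n e).mono inter_subset_right
  · rw [← hut]
    ext x
    constructor
    · rintro ⟨hx, y, hy, rfl⟩
      exact ⟨⟨y, ⟨hx, hy⟩, rfl⟩, y, hy, rfl⟩
    · rintro ⟨⟨y, ⟨hx, hy⟩, rfl⟩, -⟩
      exact ⟨hx, y, hy, rfl⟩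

theorem continuousOn_biUnion_finset {ι X Y : Type*} [TopologicalSpace X] [TopologicalSpace Y]
    {h : X → Y} {s : ι → Set X} (t : Finset ι) (hs : ∀ i, IsClosed (s i))
    (hc : ∀ i ∈ t, ContinuousOn h (s i)) : ContinuousOn h (⋃ i ∈ t, s i) := by
  rw [show ⋃ i ∈ t, s i = ⋃ i : t, s i from (iUnion_subtype (· ∈ t) fun i => s i).symm]
  exact (locallyFinite_of_finite _).continuousOn_iUnion (fun i => hs _) fun i => hc _ i.2

/-- On a closed ball, a function on the sphere extends to the ball with prescribed values `0` and
`1` on two closed sets. -/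
theorem exists_extension_closedBall {n : ℕ} {k : (Fin n → ℝ) → ℝ} {A B : Set (Fin n → ℝ)}
    (hA : IsClosed A) (hB : IsClosed B)
    (hk : ContinuousOn k (sphere 0 1)) (hI : ∀ y, k y ∈ Icc (0 : ℝ) 1)
    (hkA : ∀ y ∈ A, k y = 0) (hkB : ∀ y ∈ B, k y = 1) :
    ∃ g : C(Fin n → ℝ, ℝ), (∀ y, g y ∈ Icc (0 : ℝ) 1) ∧ (∀ y ∈ sphere 0 1, g y = k y) ∧
      (∀ y ∈ A, g y = 0) ∧ ∀ y ∈ B, g y = 1 := by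
  -- Being constant on `A` and on `B`, `k` is continuous on the closed union, so Tietze's theorem
  -- applies.
  have hc : ContinuousOn k (sphere 0 1 ∪ (A ∪ B)) := by
    refine hk.union_of_isClosed (ContinuousOn.union_of_isClosed ?_ ?_ hA hB) isClosed_sphere
      (hA.union hB)
    · exact continuousOn_const.congr hkA
    · exact continuousOn_const.congr hkB
  obtain ⟨g, hg, hgk⟩ := ContinuousMap.exists_restrict_eq_forall_mem_of_closed
    (⟨_, hc.domRestrict⟩ : C(↥(sphere (0 : Fin n → ℝ) 1 ∪ (A ∪ B)), ℝ)) (t := Icc (0 : ℝ) 1)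
    (fun y => hI _) ⟨0, by simp⟩ (isClosed_sphere.union (hA.union hB))
  have key : ∀ y ∈ sphere (0 : Fin n → ℝ) 1 ∪ (A ∪ B), g y = k y := fun y hy =>
    DFunLike.congr_fun hgk ⟨y, hy⟩
  exact ⟨g, hg, fun y hy => key y (.inl hy), fun y hy => (key y (.inr (.inl hy))).trans (hkA y hy),
    fun y hy => (key y (.inr (.inr hy))).trans (hkB y hy)⟩

variable {K : Type u} [TopologicalSpace K] [CWComplex (univ : Set K)]

variable (K) in
theorem Topology.CWComplex.exists_dim : ∃ d : K → ℕ,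
    ∀ (n : ℕ) (e : cell (univ : Set K) n), ∀ x ∈ openCell n e, d x = n := by
  have h : ∀ x : K, ∃ n, ∃ e : cell (univ : Set K) n, x ∈ openCell n e := fun x => by
    have : x ∈ ⋃ (n : ℕ) (j : cell (univ : Set K) n), openCell n j := by
      rw [iUnion_openCell_eq_complex]; trivial
    simpa using this
  choose d e hd using h
  refine ⟨d, fun n e' x hx => ?_⟩
  have := eq_of_not_disjoint_openCell (not_disjoint_iff.2 ⟨x, hd x, hx⟩)
  exact congrArg Sigma.fst this

theorem Topology.CWComplex.dim_lt_of_mem_cellFrontier {d : K → ℕ}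
    (hd : ∀ (n : ℕ) (e : cell (univ : Set K) n), ∀ x ∈ openCell n e, d x = n) {n : ℕ}
    {e : cell (univ : Set K) n} {x : K} (hx : x ∈ cellFrontier n e) : d x < n := by
  obtain ⟨J, hJ⟩ := cellFrontier_subset_finite_openCell n e
  have := hJ hx
  simp only [mem_iUnion] at this
  obtain ⟨m, hm, j, -, hj⟩ := this
  exact (hd m j x hj).trans_lt hm

theorem Topology.CWComplex.dim_le_of_mem_closedCell {d : K → ℕ}
    (hd : ∀ (n : ℕ) (e : cell (univ : Set K) n), ∀ x ∈ openCell n e, d x = n) {n : ℕ}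
    {e : cell (univ : Set K) n} {x : K} (hx : x ∈ closedCell n e) : d x ≤ n := by
  rw [← cellFrontier_union_openCell_eq_closedCell] at hx
  exact hx.elim (fun h => (dim_lt_of_mem_cellFrontier hd h).le) fun h => (hd n e x h).le

variable [T2Space K]

/-- A function separating `A` from `B` which is continuous on the cells of dimension `< n`. -/
structure IsSeparatingBelow (A B : Set K) (n : ℕ) (h : K → ℝ) : Prop where
  mem_Icc : ∀ x, h x ∈ Icc (0 : ℝ) 1
  zero : ∀ x ∈ A, h x = 0
  one : ∀ x ∈ B, h x = 1
  continuousOn : ∀ m < n, ∀ e : cell (univ : Set K) m, ContinuousOn h (closedCell m e)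

/-- The frontier of an `n`-cell lies in finitely many closed cells of lower dimension, so `h` is
continuous there and extends over the ball. Only values on open `n`-cells change; this keeps the
lower cells intact and makes the sequence of functions stabilize. -/
theorem IsSeparatingBelow.exists_succ {d : K → ℕ}
    (hd : ∀ (n : ℕ) (e : cell (univ : Set K) n), ∀ x ∈ openCell n e, d x = n)
    {A B : Set K} (hA : IsClosed A) (hB : IsClosed B) {n : ℕ} {h : K → ℝ}
    (hh : IsSeparatingBelow A B n h) :
    ∃ h', IsSeparatingBelow A B (n + 1) h' ∧ ∀ x, d x ≠ n → h' x = h x := by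
  classical
  have hsphere : ∀ e : cell (univ : Set K) n,
      ContinuousOn (h ∘ RelCWComplex.map n e) (sphere 0 1) := fun e => by
    obtain ⟨J, hJ⟩ := cellFrontier_subset_finite_closedCell n e
    have hc : ContinuousOn h
        (⋃ a ∈ (Finset.range n).sigma J, closedCell a.1 a.2) :=
      continuousOn_biUnion_finset _ (fun _ => isClosed_closedCell) fun a ha =>
        hh.continuousOn _ (Finset.mem_range.1 (Finset.mem_sigma.1 ha).1) _
    refine hc.comp ((RelCWComplex.continuousOn n e).mono sphere_subset_closedBall) fun y hy => ?_
    have := hJ ⟨y, hy, rfl⟩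
    simp only [mem_iUnion] at this ⊢
    obtain ⟨m, hm, j, hj, hy⟩ := this
    exact ⟨⟨m, j⟩, Finset.mem_sigma.2 ⟨Finset.mem_range.2 hm, hj⟩, hy⟩
  have hcl : ∀ (e : cell (univ : Set K) n) {S : Set K}, IsClosed S →
      IsClosed (closedBall 0 1 ∩ RelCWComplex.map n e ⁻¹' S) := fun e S hS =>
    (RelCWComplex.continuousOn n e).preimage_isClosed_of_isClosed isClosed_closedBall hS
  have hext := fun e : cell (univ : Set K) n => exists_extension_closedBall (hcl e hA) (hcl e hB)
    (hsphere e)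
    (fun y => hh.mem_Icc _) (fun y hy => hh.zero _ hy.2) (fun y hy => hh.one _ hy.2)
  choose g hgI hgS hgA hgB using hext
  let h' : K → ℝ := fun x => if H : ∃ e : cell (univ : Set K) n, x ∈ openCell n e then
    g H.choose ((RelCWComplex.map n H.choose).symm x) else h x
  have hmap : ∀ (e : cell (univ : Set K) n), ∀ y ∈ ball 0 1,
      h' (RelCWComplex.map n e y) = g e y := fun e y hy => by
    have H : ∃ e' : cell (univ : Set K) n, RelCWComplex.map n e y ∈ openCell n e' :=
      ⟨e, y, hy, rfl⟩
    have he : H.choose = e := by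
      have := eq_of_not_disjoint_openCell (not_disjoint_iff.2 ⟨_, H.choose_spec, ⟨y, hy, rfl⟩⟩)
      simpa using this
    simp only [h', dif_pos H, he]
    rw [(RelCWComplex.map n e).left_inv (by rwa [RelCWComplex.source_eq])]
  have hne : ∀ x, d x ≠ n → h' x = h x := fun x hx => dif_neg fun ⟨e, he⟩ => hx (hd n e x he)
  have hcases : ∀ x, h' x = h x ∨ ∃ (e : cell (univ : Set K) n) (y : Fin n → ℝ),
      y ∈ ball 0 1 ∧ RelCWComplex.map n e y = x ∧ h' x = g e y := fun x => by
    by_cases H : ∃ e : cell (univ : Set K) n, x ∈ openCell n e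
    · obtain ⟨e, y, hy, rfl⟩ := H
      exact .inr ⟨e, y, hy, rfl, hmap e y hy⟩
    · exact .inl (dif_neg H)
  refine ⟨h', ⟨fun x => ?_, fun x hx => ?_, fun x hx => ?_, fun m hm e => ?_⟩, hne⟩
  · obtain H | ⟨e, y, hy, rfl, H⟩ := hcases x
    · exact H ▸ hh.mem_Icc x
    · exact H ▸ hgI e y
  · obtain H | ⟨e, y, hy, rfl, H⟩ := hcases x
    · exact H.trans (hh.zero x hx)
    · exact H.trans (hgA e y ⟨ball_subset_closedBall hy, hx⟩)
  · obtain H | ⟨e, y, hy, rfl, H⟩ := hcases x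
    · exact H.trans (hh.one x hx)
    · exact H.trans (hgB e y ⟨ball_subset_closedBall hy, hx⟩)
  · obtain hm | rfl := Nat.lt_succ_iff_lt_or_eq.1 hm
    · exact (hh.continuousOn m hm e).congr fun x hx =>
        hne x ((dim_le_of_mem_closedCell hd hx).trans_lt hm).ne
    · refine RelCWComplex.continuousOn_closedCell ((g e).continuous.continuousOn.congr fun y hy => ?_)
      rw [← ball_union_sphere] at hy
      obtain hy | hy := hy
      · exact hmap e y hy
      · exact (hne _ (dim_lt_of_mem_cellFrontier hd ⟨y, hy, rfl⟩).ne).trans (hgS e y hy).symm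

variable (K) in
/-- CW complexes are normal. -/
theorem Topology.CWComplex.normalSpace : NormalSpace K := by
  classical
  refine ⟨fun A B hA hB hAB => ?_⟩
  obtain ⟨d, hd⟩ := exists_dim K
  choose! F hF hFd using fun (n : ℕ) (h : K → ℝ) (hh : IsSeparatingBelow A B n h) =>
    hh.exists_succ hd hA hB
  -- At stage `0` no continuity is required, so an indicator function will do.
  let h : ℕ → K → ℝ := fun n => Nat.rec (B.indicator 1) F n
  have hsep : ∀ n, IsSeparatingBelow A B n (h n) := fun n => by
    induction n with
    | zero =>
      refine ⟨fun x => ?_, fun x hx => ?_, fun x hx => ?_, fun m hm => absurd hm (by simp)⟩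
      · by_cases hx : x ∈ B <;> simp [h, hx]
      · simp [h, hAB.notMem_of_mem_left hx]
      · simp [h, hx]
    | succ n ih => exact hF n _ ih
  have hstable : ∀ x k, h (d x + 1 + k) x = h (d x + 1) x := fun x k => by
    induction k with
    | zero => rfl
    | succ k ih => exact (hFd _ _ (hsep (d x + 1 + k)) x (by omega)).trans ih
  -- The value at `x` is final from stage `d x + 1` on, so `φ` agrees with `h (n + 1)` on each
  -- closed `n`-cell, and continuity can be tested there.
  let φ : K → ℝ := fun x => h (d x + 1) x
  have hφ : Continuous φ := by
    refine continuous_iff_isClosed.2 fun S hS => (closed univ _ (subset_univ _)).2 fun n e => ?_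
    have hc : ContinuousOn φ (closedCell n e) :=
      ((hsep (n + 1)).continuousOn n n.lt_succ_self e).congr fun x hx => by
        obtain ⟨k, hk⟩ := Nat.exists_eq_add_of_le (dim_le_of_mem_closedCell hd hx)
        rw [hk, add_right_comm]
        exact (hstable x k).symm
    rw [inter_comm]
    exact hc.preimage_isClosed_of_isClosed isClosed_closedCell hS
  refine ⟨φ ⁻¹' Iio (1 / 2), φ ⁻¹' Ioi (1 / 2), isOpen_Iio.preimage hφ, isOpen_Ioi.preimage hφ,
    fun x hx => ?_, fun x hx => ?_, ?_⟩
  · simp [φ, (hsep _).zero x hx]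
  · simp only [mem_preimage, mem_Ioi, φ, (hsep _).one x hx]; norm_num
  · exact Disjoint.preimage _ (Iio_disjoint_Ioi_same)

end CWNormal

/-! ### Strict lifts, lifts up to homotopy and path fibrations -/

section Lifts

variable {X X' Z Y : Type u} [TopologicalSpace X] [TopologicalSpace X'] [TopologicalSpace Z]
  [TopologicalSpace Y]

/-- `f` factors through `q`. -/
def LiftsTo (f : C(X, Y)) (q : C(Z, Y)) : Prop :=
  ∃ s : C(X, Z), q.comp s = f

/-- `f` factors through `q` up to homotopy. -/
def LiftsUpTo (f : C(X, Y)) (q : C(Z, Y)) : Prop :=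
  ∃ s : C(X, Z), (q.comp s).Homotopic f

theorem LiftsTo.comp {f : C(X, Y)} {q : C(Z, Y)} (h : LiftsTo f q) (k : C(X', X)) :
    LiftsTo (f.comp k) q := by
  obtain ⟨s, rfl⟩ := h
  exact ⟨s.comp k, rfl⟩

theorem LiftsUpTo.comp {f : C(X, Y)} {q : C(Z, Y)} (h : LiftsUpTo f q) (k : C(X', X)) :
    LiftsUpTo (f.comp k) q := by
  obtain ⟨s, hs⟩ := h
  exact ⟨s.comp k, hs.comp (.refl k)⟩

theorem LiftsUpTo.homotopic {f f' : C(X, Y)} {q : C(Z, Y)} (h : LiftsUpTo f q)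
    (hf : f.Homotopic f') : LiftsUpTo f' q := by
  obtain ⟨s, hs⟩ := h
  exact ⟨s, hs.trans hf⟩

theorem LiftsTo.liftsUpTo {f : C(X, Y)} {q : C(Z, Y)} (h : LiftsTo f q) : LiftsUpTo f q := by
  obtain ⟨s, rfl⟩ := h
  exact ⟨s, .refl _⟩

/-- Lifting up to homotopy can be transported along maps over `Y` up to homotopy. -/
theorem LiftsUpTo.trans {f : C(X, Y)} {q : C(Z, Y)} {q' : C(X', Y)} (h : LiftsUpTo f q)
    (hq : LiftsUpTo q q') : LiftsUpTo f q' := by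
  obtain ⟨s, hs⟩ := h
  obtain ⟨k, hk⟩ := hq
  exact ⟨k.comp s, (ContinuousMap.Homotopic.comp hk (.refl s)).trans hs⟩

/-- Lift the homotopy from `q ∘ s` to `f`, starting at `s`; the end of the lifted homotopy is a
strict lift. -/
theorem IsHurewiczFibration.liftsTo {q : C(Z, Y)} (hq : IsHurewiczFibration q) {f : C(X, Y)}
    (h : LiftsUpTo f q) : LiftsTo f q := by
  obtain ⟨s, ⟨H⟩⟩ := h
  obtain ⟨G, -, hG⟩ := hq X s ⟨fun x => H (x.2, x.1), by fun_prop⟩ (fun a => by simp)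
  refine ⟨⟨fun x => G (x, 1), by fun_prop⟩, ?_⟩
  ext x
  exact (hG _).trans (by simp)

/-- The total space of the path fibration that replaces `q`. -/
abbrev PathObject (q : C(Z, Y)) : Type u :=
  {x : Z × C(I, Y) // x.2 0 = q x.1}

/-- The path fibration that replaces `q`. -/
def pathProj (q : C(Z, Y)) : C(PathObject q, Y) :=
  ⟨fun x => x.1.2 1, by fun_prop⟩

/-- By currying, a map to the path object over `f` is a map `s` together with a homotopy from `q ∘
s` to `f`. -/
theorem liftsTo_pathProj_iff {f : C(X, Y)} {q : C(Z, Y)} :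
    LiftsTo f (pathProj q) ↔ LiftsUpTo f q := by
  constructor
  · rintro ⟨s, rfl⟩
    refine ⟨⟨fun x => (s x).1.1, by fun_prop⟩, ⟨⟨⟨fun x => (s x.2).1.2 x.1, by fun_prop⟩, ?_, ?_⟩⟩⟩
    · exact fun x => (s x).2
    · exact fun x => rfl
  · rintro ⟨s, ⟨H⟩⟩
    obtain ⟨c, hc⟩ : ∃ c : C(X, C(I, Y)), ∀ x t, c x t = H (t, x) :=
      ⟨ContinuousMap.curry ⟨fun x => H (x.2, x.1), by fun_prop⟩, fun _ _ => rfl⟩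
    refine ⟨⟨fun x => ⟨(s x, c x), (hc x 0).trans (H.map_zero_left x)⟩, by fun_prop⟩, ?_⟩
    ext x
    exact (hc x 1).trans (H.map_one_left x)

theorem LiftsTo.restrict_mono {f : C(X, Y)} {q : C(Z, Y)} {U V : Set X}
    (h : LiftsTo (f.restrict U) q) (hVU : V ⊆ U) : LiftsTo (f.restrict V) q :=
  h.comp ⟨Set.inclusion hVU, continuous_inclusion hVU⟩

end Lifts

/-! ### Open parts of the double mapping cylinder -/

namespace DoubleCylinder

variable {P Z W Y T : Type u} [TopologicalSpace P] [TopologicalSpace Z] [TopologicalSpace W]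
  [TopologicalSpace Y] [TopologicalSpace T]

/-- The quotient map onto the double mapping cylinder. -/
def mk (a : C(P, Z)) (b : C(P, W)) : (P × I) ⊕ (Z ⊕ W) → DoubleCylinder a b :=
  Quot.mk _

variable {a : C(P, Z)} {b : C(P, W)}

theorem isQuotientMap_mk : Topology.IsQuotientMap (mk a b) :=
  isQuotientMap_quot_mk

@[fun_prop]
theorem continuous_mk : Continuous (mk a b) :=
  isQuotientMap_mk.continuous

theorem mk_zero (x : P) : mk a b (.inl (x, 0)) = mk a b (.inr (.inl (a x))) :=
  Quot.sound (.zero x)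

theorem mk_one (x : P) : mk a b (.inl (x, 1)) = mk a b (.inr (.inr (b x))) :=
  Quot.sound (.one x)

variable (a b) in
/-- The coordinate `[x, t] ↦ t`, which is `0` and `1` on the two ends. -/
def height : C(DoubleCylinder a b, I) where
  toFun := Quot.lift (Sum.elim Prod.snd (Sum.elim (fun _ => 0) fun _ => 1)) (by
    rintro _ _ (x | x) <;> rfl)
  continuous_toFun := isQuotientMap_mk.continuous_iff.2 <|
    continuous_snd.sumElim (continuous_const.sumElim continuous_const)

/-- A map into `OnePoint T` compatible with the identifications which is continuous and finite over
an open subset of the double mapping cylinder induces a map from that subset to `T`. -/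
theorem exists_map_of_isOpen {S : Set (DoubleCylinder a b)} (hS : IsOpen S)
    (G : (P × I) ⊕ (Z ⊕ W) → OnePoint T) (hG : ∀ y y', CylinderRel a b y y' → G y = G y')
    (hc : ∀ y, mk a b y ∈ S → ContinuousAt G y) (hfin : ∀ y, mk a b y ∈ S → G y ≠ OnePoint.infty) :
    ∃ F : C(S, T), ∀ y (hy : mk a b y ∈ S), (F ⟨mk a b y, hy⟩ : OnePoint T) = G y := by
  -- The value `∞` makes the map total, so that it descends to the whole quotient without a default
  -- point of `T`; as `T` is open in `OnePoint T`, continuity over `S` is not affected.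
  let G' : DoubleCylinder a b → OnePoint T := Quot.lift G hG
  have hG' : ContinuousOn G' S := (isQuotientMap_mk.continuousOn_isOpen_iff hS).2 fun y hy =>
    (hc y hy).continuousWithinAt
  have hex : ∀ d : S, ∃ t : T, (t : OnePoint T) = G' d := by
    rintro ⟨d, hd⟩
    obtain ⟨y, rfl⟩ := isQuotientMap_mk.surjective d
    exact OnePoint.ne_infty_iff_exists.1 (hfin y hd)
  choose F hF using hex
  refine ⟨⟨F, OnePoint.isOpenEmbedding_coe.continuous_iff.2 ?_⟩, fun y hy => hF _⟩
  rw [show ((↑) : T → OnePoint T) ∘ F = S.domRestrict G' from funext hF]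
  exact continuousOn_iff_continuous_domRestrict.1 hG'

theorem exists_map_height_lt_one (k : C(Z, T)) (l : C(P × I, T)) (hl : ∀ x, l (x, 0) = k (a x)) :
    ∃ F : C({d | height a b d < 1}, T), (∀ z h, F ⟨mk a b (.inr (.inl z)), h⟩ = k z) ∧
      ∀ x h, F ⟨mk a b (.inl x), h⟩ = l x := by
  have hS : IsOpen {d | height a b d < 1} := isOpen_lt (by fun_prop) continuous_const
  let G : (P × I) ⊕ (Z ⊕ W) → OnePoint T :=
    Sum.elim (fun x => if x.2 < 1 then (l x : OnePoint T) else OnePoint.infty)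
      (Sum.elim (fun z => (k z : OnePoint T)) fun _ => OnePoint.infty)
  have hc : ∀ y, mk a b y ∈ {d | height a b d < 1} → ContinuousAt G y := by
    rintro (x | z | w) hy
    · rw [← Topology.IsOpenEmbedding.inl.continuousAt_iff]
      have h' : ∀ᶠ x' in nhds x, x'.2 < 1 := continuous_snd.continuousAt.eventually_lt_const hy
      have hc : ContinuousAt (fun x => (l x : OnePoint T)) x :=
        (OnePoint.continuous_coe.comp l.continuous).continuousAt
      refine hc.congr (h'.mono fun x' hx' => ?_)
      simp [G, hx']
    · rw [← Topology.IsOpenEmbedding.inr.continuousAt_iff,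
        ← Topology.IsOpenEmbedding.inl.continuousAt_iff]
      exact (OnePoint.continuous_coe.comp k.continuous).continuousAt
    · exact absurd (show (1 : I) < 1 from hy) (lt_irrefl _)
  have hfin : ∀ y, mk a b y ∈ {d | height a b d < 1} → G y ≠ OnePoint.infty := by
    rintro (x | z | w) hy
    · have h' : x.2 < 1 := hy
      simp [G, h']
    · simp [G]
    · exact absurd (show (1 : I) < 1 from hy) (lt_irrefl _)
  obtain ⟨F, hF⟩ := exists_map_of_isOpen hS G (by rintro _ _ (x | x) <;> simp [G, hl]) hc hfin
  refine ⟨F, fun z h => OnePoint.coe_injective (hF _ h), fun x h => OnePoint.coe_injective ?_⟩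
  have h' : x.2 < 1 := h
  exact (hF _ h).trans (by simp [G, h'])

theorem exists_map_height_pos (k : C(W, T)) (l : C(P × I, T)) (hl : ∀ x, l (x, 1) = k (b x)) :
    ∃ F : C({d | 0 < height a b d}, T), (∀ w h, F ⟨mk a b (.inr (.inr w)), h⟩ = k w) ∧
      ∀ x h, F ⟨mk a b (.inl x), h⟩ = l x := by
  have hS : IsOpen {d | 0 < height a b d} := isOpen_lt continuous_const (by fun_prop)
  let G : (P × I) ⊕ (Z ⊕ W) → OnePoint T :=
    Sum.elim (fun x => if 0 < x.2 then (l x : OnePoint T) else OnePoint.infty)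
      (Sum.elim (fun _ => OnePoint.infty) fun w => (k w : OnePoint T))
  have hc : ∀ y, mk a b y ∈ {d | 0 < height a b d} → ContinuousAt G y := by
    rintro (x | z | w) hy
    · rw [← Topology.IsOpenEmbedding.inl.continuousAt_iff]
      have h' : ∀ᶠ x' in nhds x, 0 < x'.2 := continuous_snd.continuousAt.eventually_const_lt hy
      have hc : ContinuousAt (fun x => (l x : OnePoint T)) x :=
        (OnePoint.continuous_coe.comp l.continuous).continuousAt
      refine hc.congr (h'.mono fun x' hx' => ?_)
      simp [G, hx']
    · exact absurd (show (0 : I) < 0 from hy) (lt_irrefl _)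
    · rw [← Topology.IsOpenEmbedding.inr.continuousAt_iff,
        ← Topology.IsOpenEmbedding.inr.continuousAt_iff]
      exact (OnePoint.continuous_coe.comp k.continuous).continuousAt
  have hfin : ∀ y, mk a b y ∈ {d | 0 < height a b d} → G y ≠ OnePoint.infty := by
    rintro (x | z | w) hy
    · have h' : 0 < x.2 := hy
      simp [G, h']
    · exact absurd (show (0 : I) < 0 from hy) (lt_irrefl _)
    · simp [G]
  obtain ⟨F, hF⟩ := exists_map_of_isOpen hS G (by rintro _ _ (x | x) <;> simp [G, hl]) hc hfin
  refine ⟨F, fun z h => OnePoint.coe_injective (hF _ h), fun x h => OnePoint.coe_injective ?_⟩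
  have h' : 0 < x.2 := h
  exact (hF _ h).trans (by simp [G, h'])

section

variable {q : C(Z, Y)} {r : C(W, Y)} {H : C(P × I, Y)} {h0 : ∀ x, H (x, 0) = q (a x)}
  {h1 : ∀ x, H (x, 1) = r (b x)}

/-- Slide `[x, t]` to the left end. The lift to the path object sends it to `a x` with the path `s ↦
H (x, t * s)`, which is constant at `t = 0` and so matches the constant paths over `Z`. -/
theorem liftsUpTo_desc_height_lt_one :
    LiftsUpTo ((desc a b q r H h0 h1).restrict {d | height a b d < 1}) q := by
  rw [← liftsTo_pathProj_iff]
  let c : C(P × I, C(I, Y)) :=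
    ContinuousMap.curry ⟨fun y => H (y.1.1, y.1.2 * y.2), by fun_prop⟩
  have hc : ∀ x t s, c (x, t) s = H (x, t * s) := fun _ _ _ => rfl
  let e : C(Z, C(I, Y)) := ContinuousMap.curry ⟨fun y => q y.1, by fun_prop⟩
  obtain ⟨F, hFl, hF⟩ := exists_map_height_lt_one (a := a) (b := b) (T := PathObject q)
    ⟨fun z => ⟨(z, e z), rfl⟩, by fun_prop⟩
    ⟨fun y => ⟨(a y.1, c y), by simp [hc, h0]⟩, by fun_prop⟩ (fun x => by
      refine Subtype.ext (Prod.ext rfl (ContinuousMap.ext fun s => ?_))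
      exact (hc _ _ _).trans (by simp [h0, e]))
  refine ⟨F, ContinuousMap.ext fun d => ?_⟩
  obtain ⟨d, hd⟩ := d
  obtain ⟨x | z | w, rfl⟩ := isQuotientMap_mk.surjective d
  · exact (congrArg (pathProj q) (hF x hd)).trans
      ((hc _ _ _).trans (congrArg H (Prod.ext rfl (mul_one _))))
  · exact congrArg (pathProj q) (hFl z hd)
  · exact absurd (show (1 : I) < 1 from hd) (lt_irrefl _)

theorem liftsUpTo_desc_height_pos :
    LiftsUpTo ((desc a b q r H h0 h1).restrict {d | 0 < height a b d}) r := by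
  rw [← liftsTo_pathProj_iff]
  -- The parameter `1 - (1 - t) * s` runs from the right end `1` to `t`.
  let c : C(P × I, C(I, Y)) :=
    ContinuousMap.curry ⟨fun y => H (y.1.1, σ (σ y.1.2 * y.2)), by fun_prop⟩
  have hc : ∀ x t s, c (x, t) s = H (x, σ (σ t * s)) := fun _ _ _ => rfl
  let e : C(W, C(I, Y)) := ContinuousMap.curry ⟨fun y => r y.1, by fun_prop⟩
  obtain ⟨F, hFr, hF⟩ := exists_map_height_pos (a := a) (b := b) (T := PathObject r)
    ⟨fun w => ⟨(w, e w), rfl⟩, by fun_prop⟩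
    ⟨fun y => ⟨(b y.1, c y), by simp [hc, h1]⟩, by fun_prop⟩ (fun x => by
      refine Subtype.ext (Prod.ext rfl (ContinuousMap.ext fun s => ?_))
      exact (hc _ _ _).trans (by simp [h1, e]))
  refine ⟨F, ContinuousMap.ext fun d => ?_⟩
  obtain ⟨d, hd⟩ := d
  obtain ⟨x | z | w, rfl⟩ := isQuotientMap_mk.surjective d
  · exact (congrArg (pathProj r) (hF x hd)).trans
      ((hc _ _ _).trans (congrArg H (Prod.ext rfl (by simp))))
  · exact absurd (show (0 : I) < 0 from hd) (lt_irrefl _)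
  · exact congrArg (pathProj r) (hFr w hd)

/-- A map that lifts up to homotopy to a double mapping cylinder lifts up to homotopy to the two
ends over two open sets which cover its domain. -/
theorem exists_open_cover {X : Type u} [TopologicalSpace X] {f : C(X, Y)}
    (hf : LiftsUpTo f (desc a b q r H h0 h1)) :
    ∃ U V : Set X, IsOpen U ∧ IsOpen V ∧ U ∪ V = Set.univ ∧ LiftsUpTo (f.restrict U) q ∧
      LiftsUpTo (f.restrict V) r := by
  obtain ⟨s, hs⟩ := hf
  have key : ∀ S : Set (DoubleCylinder a b),
      ((((desc a b q r H h0 h1).restrict S).comp (s.restrictPreimage S)).Homotopic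
        (f.restrict (s ⁻¹' S))) := fun S =>
    ContinuousMap.Homotopic.comp hs (.refl (⟨Subtype.val, continuous_subtype_val⟩ : C(s ⁻¹' S, X)))
  refine ⟨s ⁻¹' {d | height a b d < 1}, s ⁻¹' {d | 0 < height a b d},
    (isOpen_lt (by fun_prop) continuous_const).preimage s.continuous,
    (isOpen_lt continuous_const (by fun_prop)).preimage s.continuous, ?_,
    (liftsUpTo_desc_height_lt_one.comp _).homotopic (key _),
    (liftsUpTo_desc_height_pos.comp _).homotopic (key _)⟩
  refine Set.eq_univ_of_forall fun x => ?_
  obtain h | h := (unitInterval.le_one (x := height a b (s x))).lt_or_eq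
  · exact .inl h
  · exact .inr (zero_lt_one.trans_eq h.symm)

end

end DoubleCylinder

/-! ### Gluing lifts in joins -/

section Gluing

variable {X Z W Y : Type u} [TopologicalSpace X] [TopologicalSpace Z] [TopologicalSpace W]
  [TopologicalSpace Y]

/-- If `f` lifts to `q` over `{t < 1}` and to `r` over `{0 < t}`, then it lifts to the fiberwise
join of `q` and `r`. -/
theorem LiftsTo.fiberwiseJoin {f : C(X, Y)} {q : C(Z, Y)} {r : C(W, Y)} (t : C(X, ℝ))
    (hq : LiftsTo (f.restrict {x | t x < 1}) q) (hr : LiftsTo (f.restrict {x | 0 < t x}) r) :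
    LiftsTo f (fiberwiseJoin q r).proj := by
  classical
  obtain ⟨a, ha⟩ := hq
  obtain ⟨b, hb⟩ := hr
  have ha' : ∀ x h, q (a ⟨x, h⟩) = f x := fun x h => DFunLike.congr_fun ha ⟨x, h⟩
  have hb' : ∀ x h, r (b ⟨x, h⟩) = f x := fun x h => DFunLike.congr_fun hb ⟨x, h⟩
  have hab : ∀ x h1 h0, q (a ⟨x, h1⟩) = r (b ⟨x, h0⟩) := fun x h1 h0 =>
    (ha' x h1).trans (hb' x h0).symm
  -- `τ` is `0` for `t ≤ 1 / 3` and `1` for `2 / 3 ≤ t`, so near the points where one lift may be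
  -- undefined the glued map uses only the other.
  let τ : X → I := fun x => Set.projIcc 0 1 zero_le_one (3 * t x - 1)
  have hτ : Continuous τ := continuous_projIcc.comp (by fun_prop)
  let A : C(FiberProduct q r, Z) := ⟨fun x => x.1.1, by fun_prop⟩
  let B : C(FiberProduct q r, W) := ⟨fun x => x.1.2, by fun_prop⟩
  let π : (FiberProduct q r × I) ⊕ (Z ⊕ W) → DoubleCylinder A B := DoubleCylinder.mk A B
  have hπ : Continuous π := DoubleCylinder.continuous_mk
  let s : X → DoubleCylinder A B := fun x =>
    if h0 : t x ≤ 1 / 3 then π (.inr (.inl (a ⟨x, h0.trans_lt (by norm_num)⟩)))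
    else if h1 : 2 / 3 ≤ t x then π (.inr (.inr (b ⟨x, lt_of_lt_of_le (by norm_num) h1⟩)))
    else π (.inl (⟨(a ⟨x, (not_le.1 h1).trans (by norm_num)⟩,
      b ⟨x, lt_trans (by norm_num) (not_le.1 h0)⟩), hab _ _ _⟩, τ x))
  -- By the end identifications, the cylinder formula holds wherever both lifts exist; hence `s` is
  -- continuous on three open sets that cover `X`.
  have hmid : ∀ x (h1 : t x < 1) (h0 : 0 < t x), s x =
      π (.inl (⟨(a ⟨x, h1⟩, b ⟨x, h0⟩), hab _ _ _⟩, τ x)) := by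
    intro x h1 h0
    by_cases h3 : t x ≤ 1 / 3
    · have : τ x = 0 := Set.projIcc_of_le_left _ (by linarith)
      simp only [s, dif_pos h3, this]
      exact (DoubleCylinder.mk_zero (a := A) (b := B) ⟨(a ⟨x, h1⟩, b ⟨x, h0⟩), hab x h1 h0⟩).symm
    · by_cases h4 : 2 / 3 ≤ t x
      · have : τ x = 1 := Set.projIcc_of_right_le _ (by linarith)
        simp only [s, dif_neg h3, dif_pos h4, this]
        exact (DoubleCylinder.mk_one (a := A) (b := B) ⟨(a ⟨x, h1⟩, b ⟨x, h0⟩), hab x h1 h0⟩).symm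
      · simp only [s, dif_neg h3, dif_neg h4]
  have hcl : ContinuousOn s {x | t x < 1 / 3} := by
    rw [continuousOn_iff_continuous_domRestrict]
    have : Set.domRestrict {x | t x < 1 / 3} s = fun x => π (.inr (.inl
        (a (Set.inclusion (fun x (hx : t x < 1 / 3) => hx.trans (by norm_num)) x)))) :=
      funext fun x => dif_pos x.2.le
    rw [this]
    exact hπ.comp (continuous_inr.comp (continuous_inl.comp
      (a.continuous.comp (continuous_inclusion _))))
  have hcr : ContinuousOn s {x | 2 / 3 < t x} := by
    rw [continuousOn_iff_continuous_domRestrict]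
    have : Set.domRestrict {x | 2 / 3 < t x} s = fun x => π (.inr (.inr
        (b (Set.inclusion (fun x (hx : 2 / 3 < t x) => lt_trans (by norm_num) hx) x)))) :=
      funext fun x => (dif_neg (not_le.2 (lt_trans (by norm_num) x.2))).trans (dif_pos x.2.le)
    rw [this]
    exact hπ.comp (continuous_inr.comp (continuous_inr.comp
      (b.continuous.comp (continuous_inclusion _))))
  have hcm : ContinuousOn s {x | t x < 1 ∧ 0 < t x} := by
    rw [continuousOn_iff_continuous_domRestrict]
    have : Set.domRestrict {x | t x < 1 ∧ 0 < t x} s = fun x => π (.inl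
        (⟨(a (Set.inclusion (fun x hx => hx.1) x), b (Set.inclusion (fun x hx => hx.2) x)),
          hab _ _ _⟩, τ x.1)) :=
      funext fun x => hmid x.1 x.2.1 x.2.2
    rw [this]
    refine hπ.comp (continuous_inl.comp (.prodMk (.subtype_mk (.prodMk ?_ ?_) _)
      (hτ.comp continuous_subtype_val)))
    · exact a.continuous.comp (continuous_inclusion _)
    · exact b.continuous.comp (continuous_inclusion _)
  have hs : Continuous s := by
    have hc := t.continuous
    refine continuous_iff_continuousAt.2 fun x => ?_
    by_cases h3 : t x < 1 / 3
    · exact hcl.continuousAt ((isOpen_lt hc continuous_const).mem_nhds h3)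
    · by_cases h4 : 2 / 3 < t x
      · exact hcr.continuousAt ((isOpen_lt continuous_const hc).mem_nhds h4)
      · exact hcm.continuousAt (((isOpen_lt hc continuous_const).inter
          (isOpen_lt continuous_const hc)).mem_nhds
          ⟨show t x < 1 by linarith, show 0 < t x by linarith⟩)
  refine ⟨⟨s, hs⟩, ContinuousMap.ext fun x => ?_⟩
  change (_root_.fiberwiseJoin q r).proj (s x) = f x
  by_cases h3 : t x ≤ 1 / 3
  · simp only [s, dif_pos h3]
    exact ha' _ _
  · by_cases h4 : 2 / 3 ≤ t x
    · simp only [s, dif_neg h3, dif_pos h4]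
      exact hb' _ _
    · simp only [s, dif_neg h3, dif_neg h4]
      exact ha' _ _

/-- The path that runs through `ω` and then backwards through `ω'`, depending continuously on a
parameter. -/
theorem exists_concat_reverse (ω ω' : C(X, C(I, Y))) (h : ∀ x, ω x 1 = ω' x 1) :
    ∃ c : C(X, C(I, Y)),
      (∀ x (s : I), c x (Set.projIcc 0 1 zero_le_one ((s : ℝ) / 2)) = ω x s) ∧
      ∀ x (s : I), c x (Set.projIcc 0 1 zero_le_one (1 - (s : ℝ) / 2)) = ω' x s := by
  let φ : ℝ → I := Set.projIcc 0 1 zero_le_one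
  have hφ : Continuous φ := continuous_projIcc
  let F : C(X × I, Y) := ⟨fun p => if (p.2 : ℝ) ≤ 1 / 2 then ω p.1 (φ (2 * p.2))
      else ω' p.1 (φ (2 - 2 * p.2)), by
    refine Continuous.if_le (by fun_prop) (by fun_prop) (by fun_prop) (by fun_prop) fun p hp => ?_
    have h1 : φ (2 * p.2) = 1 := Set.projIcc_of_right_le _ (by rw [hp]; norm_num)
    have h2 : φ (2 - 2 * p.2) = 1 := Set.projIcc_of_right_le _ (by rw [hp]; norm_num)
    rw [h1, h2, h]⟩
  have hφ' : ∀ s : I, φ s = s := fun s => Set.projIcc_val _ s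
  refine ⟨F.curry, fun x s => ?_, fun x s => ?_⟩
  · have hs : ((Set.projIcc 0 1 zero_le_one ((s : ℝ) / 2) : I) : ℝ) = s / 2 :=
      congrArg Subtype.val (Set.projIcc_of_mem _ ⟨by linarith [s.2.1], by linarith [s.2.2]⟩)
    simp only [ContinuousMap.curry_apply, F, ContinuousMap.coe_mk, hs]
    rw [if_pos (by linarith [s.2.2]), mul_div_cancel₀ _ two_ne_zero, hφ']
  · have hs : ((Set.projIcc 0 1 zero_le_one (1 - (s : ℝ) / 2) : I) : ℝ) = 1 - s / 2 :=
      congrArg Subtype.val (Set.projIcc_of_mem _ ⟨by linarith [s.2.2], by linarith [s.2.1]⟩)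
    simp only [ContinuousMap.curry_apply, F, ContinuousMap.coe_mk, hs]
    split_ifs with h'
    · have : s = 1 := Subtype.ext (le_antisymm s.2.2 (by
        have : (1 : ℝ) ≤ s := by linarith
        exact this))
      subst this
      have h1 : φ (2 * (1 - ((1 : I) : ℝ) / 2)) = 1 :=
        Set.projIcc_of_right_le _ (by norm_num)
      rw [h1, h]
    · rw [show 2 - 2 * (1 - (s : ℝ) / 2) = s by ring, hφ']

/-- The comparison map over `Y` from the fiberwise join of two path fibrations to the path fibration
of the homotopy join. -/
theorem liftsTo_fiberwiseJoin_pathProj (q : C(Z, Y)) (r : C(W, Y)) :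
    LiftsTo (fiberwiseJoin (pathProj q) (pathProj r)).proj (pathProj (homotopyJoin q r).proj) := by
  obtain ⟨c, hc, hc'⟩ := exists_concat_reverse (X := FiberProduct (pathProj q) (pathProj r))
    ⟨fun x => x.1.1.1.2, by fun_prop⟩ ⟨fun x => x.1.2.1.2, by fun_prop⟩ (fun x => x.2)
  let φ : ℝ → I := Set.projIcc 0 1 zero_le_one
  have hφ : Continuous φ := continuous_projIcc
  have hφ' : ∀ s : I, φ s = s := fun s => Set.projIcc_val _ s
  have hc0 : ∀ x, c x 0 = q x.1.1.1.1 := fun x => by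
    have := hc x 0
    rw [Set.projIcc_of_le_left _ (by simp)] at this
    exact this.trans x.1.1.2
  have hc1 : ∀ x, c x 1 = r x.1.2.1.1 := fun x => by
    have := hc' x 0
    rw [Set.projIcc_of_right_le _ (by simp)] at this
    exact this.trans x.1.2.2
  let A : C(HomotopyPullback q r, Z) := ⟨fun x => x.1.1, by fun_prop⟩
  let B : C(HomotopyPullback q r, W) := ⟨fun x => x.1.2.2, by fun_prop⟩
  let π : (HomotopyPullback q r × I) ⊕ (Z ⊕ W) → DoubleCylinder A B := DoubleCylinder.mk A B
  have hπ : Continuous π := DoubleCylinder.continuous_mk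
  -- This path follows the concatenation `c x` from parameter `t` to the midpoint `1 / 2`, where the
  -- two given paths meet. At `t = 0` and `t = 1` it is the first and the second given path, as the
  -- end identifications demand.
  obtain ⟨d, hd⟩ : ∃ d : C(FiberProduct (pathProj q) (pathProj r) × I, C(I, Y)), ∀ x t s,
      d (x, t) s = c x (φ ((1 - s) * t + s / 2)) :=
    ⟨ContinuousMap.curry ⟨fun p => c p.1.1 (φ ((1 - p.2) * p.1.2 + p.2 / 2)), by fun_prop⟩,
      fun _ _ _ => rfl⟩
  let k : C(PathObject q, PathObject (homotopyJoin q r).proj) :=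
    ⟨fun x => ⟨(π (.inr (.inl x.1.1)), x.1.2), x.2⟩, .subtype_mk (.prodMk
      (hπ.comp (by fun_prop)) (by fun_prop)) _⟩
  let k' : C(PathObject r, PathObject (homotopyJoin q r).proj) :=
    ⟨fun x => ⟨(π (.inr (.inr x.1.1)), x.1.2), x.2⟩, .subtype_mk (.prodMk
      (hπ.comp (by fun_prop)) (by fun_prop)) _⟩
  let m : C(FiberProduct (pathProj q) (pathProj r) × I, HomotopyPullback q r × I) :=
    ⟨fun x => (⟨(x.1.1.1.1.1, c x.1, x.1.1.2.1.1), hc0 _, hc1 _⟩, x.2),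
      .prodMk (.subtype_mk (by fun_prop) _) (by fun_prop)⟩
  have hm : ∀ x, d x 0 = (homotopyJoin q r).proj (π (.inl (m x))) := fun x => by
    refine (hd x.1 x.2 0).trans ?_
    have : φ ((1 - ((0 : I) : ℝ)) * x.2 + ((0 : I) : ℝ) / 2) = x.2 := by simp [hφ']
    rw [this]
    rfl
  let l : C(FiberProduct (pathProj q) (pathProj r) × I, PathObject (homotopyJoin q r).proj) :=
    ⟨fun x => ⟨(π (.inl (m x)), d x), hm x⟩, .subtype_mk (.prodMk
      (hπ.comp (continuous_inl.comp m.continuous)) d.continuous) hm⟩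
  refine ⟨DoubleCylinder.desc _ _ k k' l (fun x => ?_) (fun x => ?_),
    ContinuousMap.ext fun y => ?_⟩
  · refine Subtype.ext (Prod.ext (DoubleCylinder.mk_zero (a := A) (b := B) _)
      (ContinuousMap.ext fun s => ?_))
    refine (hd x 0 s).trans (Eq.trans ?_ (hc x s))
    simp [φ]
  · refine Subtype.ext (Prod.ext (DoubleCylinder.mk_one (a := A) (b := B) _)
      (ContinuousMap.ext fun s => ?_))
    refine (hd x 1 s).trans (Eq.trans ?_ (hc' x s))
    have : (1 - (s : ℝ)) * ((1 : I) : ℝ) + s / 2 = 1 - s / 2 := by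
      rw [Set.Icc.coe_one]; ring
    rw [this]
  · obtain ⟨x | x | x, rfl⟩ := DoubleCylinder.isQuotientMap_mk.surjective y
    · refine (hd x.1 x.2 1).trans (Eq.trans ?_ (hc x.1 1))
      simp [φ]
    · rfl
    · rfl

end Gluing

/-! ### Induction on the number of open sets -/

section Induction

variable {X Y : Type u} [TopologicalSpace X] [TopologicalSpace Y]

/-- `X` is covered by `n + 1` open sets over which `f` lifts to `q` up to homotopy. -/
def HasLiftCover {Z : Type u} [TopologicalSpace Z] (f : C(X, Y)) (q : C(Z, Y)) (n : ℕ) : Prop :=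
  ∃ U : Fin (n + 1) → Set X, (∀ i, IsOpen (U i) ∧ LiftsUpTo (f.restrict (U i)) q) ∧
    ⋃ i, U i = Set.univ

/-- The space `X` varies in the induction: the cover of the open set `U` consists of open sets of
`X`, and `V` is added as the last one. -/
theorem hasLiftCover_of_liftsUpTo (J : ℕ → SpaceOver Y)
    (hJ : ∀ (n : ℕ) (X : Type u) [TopologicalSpace X] (f : C(X, Y)),
      LiftsUpTo f (J (n + 1)).proj → ∃ U V : Set X, IsOpen U ∧ IsOpen V ∧ U ∪ V = Set.univ ∧
        LiftsUpTo (f.restrict U) (J n).proj ∧ LiftsUpTo (f.restrict V) (J 0).proj)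
    (n : ℕ) (f : C(X, Y)) (hf : LiftsUpTo f (J n).proj) : HasLiftCover f (J 0).proj n := by
  induction n generalizing X with
  | zero => exact ⟨fun _ => Set.univ, fun _ => ⟨isOpen_univ,
      hf.comp ⟨Subtype.val, continuous_subtype_val⟩⟩, Set.iUnion_const _⟩
  | succ n ih =>
    obtain ⟨U, V, hU, hV, hUV, hfU, hfV⟩ := hJ n X f hf
    obtain ⟨S, hS, hSU⟩ := ih _ hfU
    let Q : Set X → Prop := fun U => IsOpen U ∧ LiftsUpTo (f.restrict U) (J 0).proj
    refine ⟨Fin.snoc (fun i => Subtype.val '' S i) V, fun i => ?_, ?_⟩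
    · change Q _
      induction i using Fin.lastCases with
      | last =>
        rw [Fin.snoc_last]
        exact ⟨hV, hfV⟩
      | cast i =>
        rw [Fin.snoc_castSucc]
        refine ⟨hU.isOpenMap_subtype_val _ (hS i).1, ?_⟩
        have hmem : ∀ x : Subtype.val '' S i, ∃ h : x.1 ∈ U, (⟨x.1, h⟩ : U) ∈ S i := by
          rintro ⟨_, y, hy, rfl⟩
          exact ⟨y.2, hy⟩
        exact (hS i).2.comp ⟨fun x => ⟨⟨x.1, (hmem x).1⟩, (hmem x).2⟩, by fun_prop⟩
    · refine Set.eq_univ_of_forall fun x => ?_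
      obtain hx | hx : x ∈ U ∪ V := hUV ▸ Set.mem_univ x
      · obtain ⟨i, hi⟩ := Set.mem_iUnion.1 (hSU ▸ Set.mem_univ (⟨x, hx⟩ : U))
        exact Set.mem_iUnion.2 ⟨i.castSucc, by simpa using ⟨hx, hi⟩⟩
      · exact Set.mem_iUnion.2 ⟨Fin.last _, by simpa using hx⟩

theorem liftsTo_of_numerable (J : ℕ → SpaceOver Y)
    (hJ : ∀ (n : ℕ) (X : Type u) [TopologicalSpace X] (f : C(X, Y)) (t : C(X, ℝ)),
      LiftsTo (f.restrict {x | t x < 1}) (J n).proj →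
        LiftsTo (f.restrict {x | 0 < t x}) (J 0).proj → LiftsTo f (J (n + 1)).proj)
    (n : ℕ) (f : C(X, Y)) (u : Fin (n + 1) → C(X, ℝ)) (hu : ∀ i x, 0 ≤ u i x)
    (hpos : ∀ x, ∃ i, 0 < u i x) (hf : ∀ i, LiftsTo (f.restrict {x | 0 < u i x}) (J 0).proj) :
    LiftsTo f (J n).proj := by
  induction n generalizing X with
  | zero =>
    have h0 : ∀ x, 0 < u 0 x := fun x => by
      obtain ⟨i, hi⟩ := hpos x
      rwa [Subsingleton.elim (α := Fin 1) i 0] at hi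
    exact (hf 0).comp ⟨fun x => ⟨x, h0 x⟩, by fun_prop⟩
  | succ n ih =>
    have hsum : ∀ x, 0 < ∑ i, u i x := fun x =>
      Finset.sum_pos' (fun i _ => hu i x) ((hpos x).imp fun i hi => ⟨Finset.mem_univ _, hi⟩)
    -- `t < 1` exactly where another `u i` is positive, and `0 < t` exactly where the last one is.
    let t : C(X, ℝ) := ⟨fun x => u (Fin.last _) x / ∑ i, u i x,
      Continuous.div (by fun_prop) (by fun_prop) fun x => (hsum x).ne'⟩
    refine hJ n X f t (ih _ (fun i => (u i.castSucc).restrict _) (fun i x => hu _ _) (fun x => ?_)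
      fun i => ?_) ((hf (Fin.last _)).restrict_mono fun x hx => (div_pos_iff_of_pos_right (hsum x)).1 hx)
    · obtain ⟨x, hx⟩ := x
      have hx' : u (Fin.last _) x < ∑ i, u i x := (div_lt_one (hsum x)).1 hx
      rw [Fin.sum_univ_castSucc] at hx'
      obtain ⟨i, -, hi⟩ := Finset.exists_ne_zero_of_sum_ne_zero
        (s := Finset.univ) (f := fun i : Fin (n + 1) => u i.castSucc x) (by linarith)
      exact ⟨i, (hu _ _).lt_of_ne' hi⟩
    · let S : Set {x | t x < 1} := {x | 0 < (u i.castSucc).restrict {x | t x < 1} x}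
      let k : C(S, {x | 0 < u i.castSucc x}) := ⟨fun x => ⟨x.1.1, x.2⟩, by fun_prop⟩
      exact (hf i.castSucc).comp k

/-- On a space with the homotopy type of a CW complex, the open sets in a finite cover over which a
map lifts up to homotopy can be taken to be cozero sets. -/
theorem HasLiftCover.exists_numerable (hX : HasCWHomotopyType X) {Z : Type u} [TopologicalSpace Z]
    {f : C(X, Y)} {q : C(Z, Y)} {n : ℕ} (h : HasLiftCover f q n) :
    ∃ u : Fin (n + 1) → C(X, ℝ), (∀ i x, 0 ≤ u i x) ∧ (∀ x, ∃ i, 0 < u i x) ∧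
      ∀ i, LiftsUpTo (f.restrict {x | 0 < u i x}) q := by
  obtain ⟨K, _, _, ⟨_⟩, ⟨e⟩⟩ := hX
  obtain ⟨U, hU, hcover⟩ := h
  have := Topology.CWComplex.normalSpace K
  obtain ⟨ρ, hρ⟩ := PartitionOfUnity.exists_isSubordinate_of_locallyFinite isClosed_univ
    (fun i => e.invFun ⁻¹' U i) (fun i => (hU i).1.preimage e.invFun.continuous)
    (locallyFinite_of_finite _) (by rw [← Set.preimage_iUnion, hcover, Set.preimage_univ])
  refine ⟨fun i => (ρ i).comp e.toFun, fun i x => ρ.nonneg i _, fun x => ?_, fun i => ?_⟩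
  · exact ρ.exists_pos (Set.mem_univ (e.toFun x))
  -- The new set need not lie in `U i`: only the round trip through `K` lands there, which is enough
  -- because it is homotopic to the identity.
  · have hmem : ∀ x, 0 < ρ i (e.toFun x) → e.invFun (e.toFun x) ∈ U i := fun x hx =>
      hρ i (subset_closure hx.ne')
    let S : Set X := {x | 0 < (ρ i).comp e.toFun x}
    let k : C(S, U i) := ⟨fun x => ⟨e.invFun (e.toFun x.1), hmem _ x.2⟩, by fun_prop⟩
    refine ((hU i).2.comp k).homotopic ?_
    exact ContinuousMap.Homotopic.comp (.comp (.refl f) e.left_inv)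
      (.refl (⟨Subtype.val, continuous_subtype_val⟩ : C(S, X)))

end Induction

/-! ### Covers versus lifts to the iterated joins -/

section Main

variable {E B Y : Type u} [TopologicalSpace E] [TopologicalSpace B] [TopologicalSpace Y]

theorem secat_eq (f : C(B, Y)) (p : C(E, B)) :
    secat f p = leastNat (HasLiftCover f (f.comp p)) :=
  rfl

theorem leastNat_congr {P Q : ℕ → Prop} (h : ∀ n, P n ↔ Q n) : leastNat P = leastNat Q := by
  rw [funext fun n => propext (h n)]

theorem HasLiftCover.trans {Z : Type u} [TopologicalSpace Z] {f : C(B, Y)} {q : C(E, Y)}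
    {q' : C(Z, Y)} {n : ℕ} (h : HasLiftCover f q n) (hq : LiftsUpTo q q') :
    HasLiftCover f q' n := by
  obtain ⟨U, hU, hcover⟩ := h
  exact ⟨U, fun i => ⟨(hU i).1, (hU i).2.trans hq⟩, hcover⟩

theorem hasLiftCover_of_liftsUpTo_iteratedJoin {q : C(E, Y)} {f : C(B, Y)} {n : ℕ}
    (h : LiftsUpTo f (iteratedJoin q n).proj) : HasLiftCover f q n :=
  hasLiftCover_of_liftsUpTo (iteratedJoin q)
    (fun _ _ _ _ hf =>
      DoubleCylinder.exists_open_cover (h0 := fun _ => rfl) (h1 := fun x => x.2) hf) n f h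

theorem hasLiftCover_of_liftsUpTo_iteratedHomotopyJoin {q : C(E, Y)} {f : C(B, Y)} {n : ℕ}
    (h : LiftsUpTo f (iteratedHomotopyJoin q n).proj) : HasLiftCover f q n :=
  hasLiftCover_of_liftsUpTo (iteratedHomotopyJoin q)
    (fun _ _ _ _ hf =>
      DoubleCylinder.exists_open_cover (h0 := fun x => x.2.1) (h1 := fun x => x.2.2) hf) n f h

theorem HasLiftCover.liftsTo_iteratedJoin (hB : HasCWHomotopyType B) {q : C(E, Y)}
    (hq : IsHurewiczFibration q) {f : C(B, Y)} {n : ℕ} (h : HasLiftCover f q n) :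
    LiftsTo f (iteratedJoin q n).proj := by
  obtain ⟨u, hu, hpos, hf⟩ := h.exists_numerable hB
  exact liftsTo_of_numerable (iteratedJoin q) (fun _ _ _ _ t ha hb => .fiberwiseJoin t ha hb)
    n f u hu hpos fun i => hq.liftsTo (hf i)

theorem HasLiftCover.liftsUpTo_iteratedHomotopyJoin (hB : HasCWHomotopyType B) {q : C(E, Y)}
    {f : C(B, Y)} {n : ℕ} (h : HasLiftCover f q n) :
    LiftsUpTo f (iteratedHomotopyJoin q n).proj := by
  obtain ⟨u, hu, hpos, hf⟩ := h.exists_numerable hB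
  rw [← liftsTo_pathProj_iff]
  -- The induction runs over path fibrations, where homotopy lifts are strict; each step glues in a
  -- fiberwise join and then applies the comparison map.
  refine liftsTo_of_numerable (fun n => ⟨_, pathProj (iteratedHomotopyJoin q n).proj⟩)
    (fun n X _ f t ha hb => ?_) n f u hu hpos fun i => liftsTo_pathProj_iff.2 (hf i)
  obtain ⟨s, hs⟩ := LiftsTo.fiberwiseJoin t ha hb
  exact hs ▸ (liftsTo_fiberwiseJoin_pathProj _ _).comp s

theorem proposition1p8 {E B Y : Type u} [TopologicalSpace E] [TopologicalSpace B]
    [TopologicalSpace Y] (hB : HasCWHomotopyType B) (p : C(E, B)) (f : C(B, Y)) :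
    (∀ (Z : Type u) [TopologicalSpace Z] (j : E ≃ₕ Z) (q : C(Z, Y)),
      IsHurewiczFibration q → q.comp j.toFun = f.comp p →
        secat f p = leastNat (fun n =>
          ∃ s : C(B, (iteratedJoin q n).carrier), (iteratedJoin q n).proj.comp s = f) ∧
        secat f p = leastNat (fun n =>
          ∃ s : C(B, (iteratedJoin q n).carrier),
            ((iteratedJoin q n).proj.comp s).Homotopic f)) ∧
    secat f p = leastNat (fun n =>
      ∃ s : C(B, (iteratedHomotopyJoin (f.comp p) n).carrier),
        ((iteratedHomotopyJoin (f.comp p) n).proj.comp s).Homotopic f) := by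
  refine ⟨fun Z _ j q hq hj => ?_, leastNat_congr fun n => ⟨fun h =>
    HasLiftCover.liftsUpTo_iteratedHomotopyJoin hB h,
    hasLiftCover_of_liftsUpTo_iteratedHomotopyJoin⟩⟩
  have h1 : LiftsUpTo (f.comp p) q := LiftsTo.liftsUpTo ⟨j.toFun, hj⟩
  have h2 : LiftsUpTo q (f.comp p) := by
    refine ⟨j.invFun, ?_⟩
    rw [← hj]
    exact ContinuousMap.Homotopic.comp (.refl q) j.right_inv
  have h : ∀ n, HasLiftCover f (f.comp p) n ↔ HasLiftCover f q n := fun n =>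
    ⟨fun h => h.trans h1, fun h => h.trans h2⟩
  rw [secat_eq]
  exact ⟨leastNat_congr fun n => (h n).trans ⟨fun h => h.liftsTo_iteratedJoin hB hq,
      fun h => hasLiftCover_of_liftsUpTo_iteratedJoin (LiftsTo.liftsUpTo h)⟩,
    leastNat_congr fun n => (h n).trans ⟨fun h => (h.liftsTo_iteratedJoin hB hq).liftsUpTo,
      hasLiftCover_of_liftsUpTo_iteratedJoin⟩⟩

end Main
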